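/- All graphs are finite and simple. For graphs $G$ and $H$, a copy of $G$ in $H$ is a (not necessarily induced) subgraph of $H$ isomorphic to $G$. Edges are regarded as two-element sets of vertices. For a map $f:E(H)\to E(H)$, a copy $G'$ of $G$ in $H$ is called $f$-exclusive if $f(e)\cap V(G')=\emptyset$ for every $e\in E(G')$. Let $s(n,G)$ be the maximum $m$ for which there exist a graph $H$ with $n$ vertices and $m$ edges and a map $f:E(H)\to E(H)$, with $f(e)\cap e=\emptyset$ for every $e\in E(H)$, such that $H$ contains no $f$-exclusive copy of $G$; let $\mathrm{ex}(n,G)$ be the maximum number of edges of an $n$-vertex graph that contains no copy of $G$. (A maximum over an empty set, which occurs only when $G$ has no edges, is taken to be $0$.) **Theorem.** Let $G$ be a graph. If $\chi(G)\ge 3$, then $s(n,G)=(1+o(1))\,\mathrm{ex}(n,G)$ as $n\to\infty$. If $G$ is bipartite, then $s(n,G)=o(n^2)$ as $n\to\infty$. -/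

import Mathlib

open Filter Asymptotics

namespace EdgeMapping

/-- A mapping `f : E(H) → E(H)` such that `f(e) ∩ e = ∅` for every edge `e` of `H`
(the edges `e` and `f(e)` are regarded as two-element sets of vertices). -/
def IsDisjointing {V : Type*} {H : SimpleGraph V} (f : H.edgeSet → H.edgeSet) : Prop :=
  ∀ e : H.edgeSet, ∀ v : V, v ∈ (e : Sym2 V) → v ∉ (f e : Sym2 V)

/-- A copy `c` of `G` in `H` (a not necessarily induced subgraph of `H`, with vertex set the
range of `c` and with edges the images under `c` of the edges of `G`) is `f`-exclusive if `f(e)`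
contains no vertex of the copy, for every edge `e` of the copy. -/
def IsExclusive {V W : Type*} {G : SimpleGraph W} {H : SimpleGraph V}
    (f : H.edgeSet → H.edgeSet) (c : SimpleGraph.Copy G H) : Prop :=
  ∀ e : G.edgeSet, ∀ w : W, c w ∉ (f (c.mapEdgeSet e) : Sym2 V)

/-- Some mapping `f : E(H) → E(H)` with `f(e) ∩ e = ∅` for all `e` admits no `f`-exclusive copy
of `G` in `H`. -/
def HasAvoidingMap {V W : Type*} (G : SimpleGraph W) (H : SimpleGraph V) : Prop :=
  ∃ f : H.edgeSet → H.edgeSet, IsDisjointing f ∧ ∀ c : SimpleGraph.Copy G H, ¬ IsExclusive f c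

open scoped Classical in
/-- `s(n, G)`: the maximum number of edges of a graph `H` on `n` vertices for which some
`f : E(H) → E(H)` with `f(e) ∩ e = ∅` for all `e` admits no `f`-exclusive copy of `G` in `H`.
If there is no such `H` (which can only happen when `G` has no edges), the value is `0`, as for
`SimpleGraph.extremalNumber`. -/
noncomputable def s (n : ℕ) {W : Type*} (G : SimpleGraph W) : ℕ :=
  Finset.sup {H : SimpleGraph (Fin n) | HasAvoidingMap G H} (fun H => H.edgeFinset.card)

end EdgeMapping

/-!
If `H` contains a blow-up of `G` with parts of size `t`, choose one vertex in each part uniformly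
and independently. An edge `e` of the resulting copy of `G` and a vertex of the copy outside `e`
are chosen independently, so `f(e)`, having two elements, contains that vertex with probability at
most `2 / t`. For `t > 2 |E(G)| |V(G)|` the union bound gives an `f`-exclusive copy. Hence `s(n, G)`
is at most the extremal number of a fixed blow-up of `G`, which has the same chromatic number as
`G` and so, by the Erdős–Stone–Simonovits theorem, the same Turán density. Conversely, a graph with
at least `2n` edges has an edge disjoint from any given one, so a dense `G`-free graph carries a
map `f` with `f(e) ∩ e = ∅`.
-/

namespace EdgeMapping

open Finset SimpleGraph Topology

section TuranDensity

variable {V W W' : Type*} {K : SimpleGraph W} {L : SimpleGraph W'}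

theorem isLittleO_natCast_choose_two :
    (fun n : ℕ ↦ (n : ℝ)) =o[atTop] (fun n : ℕ ↦ (n.choose 2 : ℝ)) := by
  have hsq : (fun n : ℕ ↦ (n : ℝ)) =o[atTop] (fun n : ℕ ↦ (n : ℝ) ^ 2) := by
    simpa only [pow_one, Function.comp_def] using
      (isLittleO_pow_pow_atTop_of_lt (𝕜 := ℝ) one_lt_two).comp_tendsto
        tendsto_natCast_atTop_atTop
  exact hsq.trans_isTheta (isTheta_choose 2).symm

theorem turanDensity_nonneg (K : SimpleGraph W) : 0 ≤ turanDensity K :=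
  ge_of_tendsto' (tendsto_turanDensity K) fun _ ↦ by positivity

theorem turanDensity_mono (h : K ⊑ L) : turanDensity K ≤ turanDensity L :=
  le_of_tendsto_of_tendsto' (tendsto_turanDensity K) (tendsto_turanDensity L) fun n ↦ by
    gcongr
    exact h.extremalNumber_le

theorem isLittleO_extremalNumber_of_turanDensity_eq_zero (h : turanDensity K = 0) :
    (fun n : ℕ ↦ (extremalNumber n K : ℝ)) =o[atTop] (fun n : ℕ ↦ (n : ℝ) ^ 2) := by
  refine IsLittleO.trans_isTheta ?_ (isTheta_choose 2)
  refine (isLittleO_iff_tendsto' ?_).2 (h ▸ tendsto_turanDensity K)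
  filter_upwards [eventually_ge_atTop 2] with n hn hzero
  exact absurd hzero (by exact_mod_cast (Nat.choose_pos hn).ne')

theorem eventually_two_mul_le_extremalNumber (h : 0 < turanDensity K) :
    ∀ᶠ n : ℕ in atTop, 2 * n ≤ extremalNumber n K := by
  have hchoose : (fun n : ℕ ↦ (n.choose 2 : ℝ)) =O[atTop] (fun n ↦ (extremalNumber n K : ℝ)) :=
    (isBigO_self_const_mul h.ne' _ _).trans (isEquivalent_extremalNumber h.ne').isBigO_symm
  filter_upwards [(isLittleO_natCast_choose_two.trans_isBigO hchoose).bound one_half_pos]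
    with n hn
  rw [Real.norm_natCast, Real.norm_natCast] at hn
  have : (2 * n : ℝ) ≤ extremalNumber n K := by linarith
  exact_mod_cast this

theorem card_edgeFinset_le_extremalNumber_add_minDegree [Fintype V] [Nonempty V]
    {H : SimpleGraph V} [DecidableRel H.Adj] (h : K.Free H) :
    #H.edgeFinset ≤ extremalNumber (Fintype.card V - 1) K + H.minDegree := by
  classical
  obtain ⟨v, hv⟩ := H.exists_minimal_degree_vertex
  rw [hv, ← Nat.sub_le_iff_le_add, ← card_edgeFinset_deleteIncidenceSet]
  exact card_edgeFinset_deleteIncidenceSet_le_extremalNumber h v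

theorem extremalNumber_succ_le_of_minDegree {c : ℝ} {n : ℕ} (hc : 0 ≤ c)
    (h : ∀ {H : SimpleGraph (Fin (n + 1))} [DecidableRel H.Adj],
      H.minDegree ≥ c * (n + 1 : ℕ) → K ⊑ H) :
    (extremalNumber (n + 1) K : ℝ) ≤ extremalNumber n K + c * (n + 1 : ℕ) := by
  conv_lhs => rw [← Fintype.card_fin (n + 1)]
  refine (extremalNumber_le_iff_of_nonneg K (by positivity)).2 fun H _ hfree ↦ ?_
  have hdegree : (H.minDegree : ℝ) < c * (n + 1 : ℕ) := lt_of_not_ge fun hge ↦ hfree (h hge)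
  have hcard : (#H.edgeFinset : ℝ) ≤ extremalNumber n K + H.minDegree := by
    exact_mod_cast Fintype.card_fin (n + 1) ▸ card_edgeFinset_le_extremalNumber_add_minDegree hfree
  exact hcard.trans (by gcongr)

theorem extremalNumber_le_of_minDegree {c : ℝ} {N : ℕ} (hc : 0 ≤ c)
    (h : ∀ n ≥ N, ∀ {H : SimpleGraph (Fin n)} [DecidableRel H.Adj],
      H.minDegree ≥ c * n → K ⊑ H) {n : ℕ} (hn : N ≤ n) :
    (extremalNumber n K : ℝ) ≤ extremalNumber N K + c * (n + 1).choose 2 := by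
  induction n, hn using Nat.le_induction with
  | base => exact le_add_of_nonneg_right (by positivity)
  | succ n hn ih =>
    calc (extremalNumber (n + 1) K : ℝ)
        ≤ extremalNumber n K + c * (n + 1 : ℕ) :=
          extremalNumber_succ_le_of_minDegree hc (h (n + 1) (by omega))
      _ ≤ extremalNumber N K + c * (n + 1).choose 2 + c * (n + 1 : ℕ) := by gcongr
      _ = extremalNumber N K + c * (n + 1 + 1).choose 2 := by
          rw [Nat.choose_succ_succ' (n + 1) 1, Nat.choose_one_right]
          push_cast
          ring

theorem turanDensity_le_of_minDegree {c : ℝ} (hc : 0 ≤ c)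
    (h : ∀ᶠ n in atTop, ∀ {H : SimpleGraph (Fin n)} [DecidableRel H.Adj],
      H.minDegree ≥ c * n → K ⊑ H) :
    turanDensity K ≤ c := by
  obtain ⟨N, hN⟩ := eventually_atTop.mp h
  have hlim : Tendsto
      (fun n : ℕ ↦ (extremalNumber N K + c) * (n / n.choose 2 : ℝ) + c) atTop (𝓝 c) := by
    simpa using (isLittleO_natCast_choose_two.tendsto_div_nhds_zero.const_mul
      (extremalNumber N K + c)).add_const c
  refine le_of_tendsto_of_tendsto (tendsto_turanDensity K) hlim ?_
  filter_upwards [eventually_ge_atTop N, eventually_ge_atTop 2] with n hNn hn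
  have hchoose : (0 : ℝ) < n.choose 2 := by exact_mod_cast Nat.choose_pos hn
  have hone : (1 : ℝ) ≤ n := by exact_mod_cast one_le_two.trans hn
  rw [div_le_iff₀ hchoose]
  calc (extremalNumber n K : ℝ)
      ≤ extremalNumber N K + c * (n + 1).choose 2 := extremalNumber_le_of_minDegree hc hN hNn
    _ = extremalNumber N K * 1 + c * n + c * n.choose 2 := by
        rw [Nat.choose_succ_succ' n 1, Nat.choose_one_right, Nat.cast_add]
        ring
    _ ≤ extremalNumber N K * n + c * n + c * n.choose 2 := by gcongr
    _ = ((extremalNumber N K + c) * (n / n.choose 2 : ℝ) + c) * n.choose 2 := by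
        field_simp

theorem turanDensity_completeEquipartiteGraph_le {r : ℕ} (hr : 0 < r) (t : ℕ) :
    turanDensity (completeEquipartiteGraph (r + 1) t) ≤ 1 - 1 / r := by
  have hinv : 1 / (r : ℝ) ≤ 1 := by
    rw [div_le_one (by positivity)]
    exact_mod_cast hr
  exact le_of_forall_pos_le_add fun ε hε ↦ turanDensity_le_of_minDegree (by linarith)
    (eventually_completeEquipartiteGraph_isContained_of_minDegree hε r t)

theorem turanDensity_le_of_colorable [Finite W] {r : ℕ} (hr : 0 < r) (h : K.Colorable (r + 1)) :
    turanDensity K ≤ 1 - 1 / r := by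
  classical
  have := Fintype.ofFinite W
  obtain ⟨C⟩ := h
  have hcontained : K ⊑ completeEquipartiteGraph (r + 1) (Fintype.card W) :=
    isContained_completeEquipartiteGraph_of_colorable C _ fun c ↦ Fintype.card_subtype_le _
  exact (turanDensity_mono hcontained).trans (turanDensity_completeEquipartiteGraph_le hr _)

theorem free_completeEquipartiteGraph_of_not_colorable {r : ℕ} (h : ¬ K.Colorable r) (t : ℕ) :
    K.Free (completeEquipartiteGraph r t) := fun ⟨c⟩ ↦
  h ⟨(Coloring.mk (α := Fin r) Prod.fst fun hadj ↦ hadj).comp c.toHom⟩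

theorem mul_choose_two_le_card_edgeFinset_completeEquipartiteGraph {r : ℕ} (hr : 0 < r) (t : ℕ) :
    (1 - 1 / r) * ((r * t).choose 2 : ℝ) ≤ #(completeEquipartiteGraph r t).edgeFinset := by
  have hr' : (1 : ℝ) ≤ r := by exact_mod_cast hr
  have hdiff : 0 ≤ ((r : ℝ) - 1) * t := mul_nonneg (by linarith) (Nat.cast_nonneg t)
  rw [card_edgeFinset_completeEquipartiteGraph, Nat.cast_mul, Nat.cast_pow, Nat.cast_choose_two,
    Nat.cast_choose_two, Nat.cast_mul]
  calc (1 - 1 / (r : ℝ)) * (r * t * (r * t - 1) / 2)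
      = r * (r - 1) / 2 * t ^ 2 - (r - 1) * t / 2 := by field_simp
    _ ≤ r * (r - 1) / 2 * t ^ 2 := by linarith

theorem le_turanDensity_of_not_colorable {r : ℕ} (hr : 0 < r) (h : ¬ K.Colorable r) :
    1 - 1 / (r : ℝ) ≤ turanDensity K := by
  have hmul : Tendsto (fun t : ℕ ↦ r * t) atTop atTop := tendsto_id.const_mul_atTop' hr
  refine ge_of_tendsto ((tendsto_turanDensity K).comp hmul) ?_
  filter_upwards [eventually_ge_atTop 2] with t ht
  have hchoose : (0 : ℝ) < (r * t).choose 2 := by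
    exact_mod_cast Nat.choose_pos (ht.trans (Nat.le_mul_of_pos_left t hr))
  have hcard : #(completeEquipartiteGraph r t).edgeFinset ≤ extremalNumber (r * t) K := by
    simpa using card_edgeFinset_le_extremalNumber
      (free_completeEquipartiteGraph_of_not_colorable h t)
  rw [Function.comp_apply, le_div_iff₀ hchoose]
  exact (mul_choose_two_le_card_edgeFinset_completeEquipartiteGraph hr t).trans
    (by exact_mod_cast hcard)

theorem turanDensity_eq_of_chromaticNumber_eq [Finite W] {r : ℕ} (hr : 0 < r)
    (h : K.chromaticNumber = r + 1) : turanDensity K = 1 - 1 / r := by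
  obtain ⟨hcol, hnot⟩ := chromaticNumber_eq_iff_colorable_not_colorable.1 h
  exact (turanDensity_le_of_colorable hr hcol).antisymm (le_turanDensity_of_not_colorable hr hnot)

theorem turanDensity_eq_zero_of_isBipartite [Finite W] (h : K.IsBipartite) :
    turanDensity K = 0 :=
  (by simpa using turanDensity_le_of_colorable one_pos h : turanDensity K ≤ 0).antisymm
    (turanDensity_nonneg K)

end TuranDensity

section Blowup

variable {W κ : Type*}

/-- The blow-up of `G` that replaces every vertex by an independent set indexed by `κ` and every
edge by a complete bipartite graph. -/
def blowup (G : SimpleGraph W) (κ : Type*) : SimpleGraph (W × κ) :=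
  G.comap Prod.fst

/-- The copy of `G` in its blow-up spanned by one representative `x w` of each vertex `w`. -/
def transversal (G : SimpleGraph W) (x : W → κ) : Copy G (blowup G κ) :=
  Hom.toCopy ⟨fun w ↦ (w, x w), id⟩ fun _ _ h ↦ congrArg Prod.fst h

theorem chromaticNumber_blowup [Nonempty κ] (G : SimpleGraph W) :
    (blowup G κ).chromaticNumber = G.chromaticNumber :=
  (chromaticNumber_mono_of_hom ⟨Prod.fst, id⟩).antisymm
    (chromaticNumber_mono_of_hom (transversal G fun _ ↦ Classical.arbitrary κ).toHom)

end Blowup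

section Avoidance

variable {ι : Type*} [DecidableEq ι]

/-- Exchanging the coordinate `x i` with an independent `a : κ i` shows that the event `x i ∈ A x`
has the same size as the event `a ∈ A x`. -/
theorem card_filter_apply_mem_mul_card_le [Fintype ι] {κ : ι → Type*}
    [∀ i, Fintype (κ i)] [∀ i, DecidableEq (κ i)] {i : ι} {m : ℕ} (A : (∀ j, κ j) → Finset (κ i))
    (hA : ∀ x a, A (Function.update x i a) = A x) (hcard : ∀ x, #(A x) ≤ m) :
    #{x | x i ∈ A x} * Fintype.card (κ i) ≤ Fintype.card (∀ j, κ j) * m := by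
  let swap : (∀ j, κ j) × κ i → Σ _ : ∀ j, κ j, κ i := fun q ↦
    ⟨Function.update q.1 i q.2, q.1 i⟩
  have hmaps : Set.MapsTo swap ↑(({x | x i ∈ A x} : Finset _) ×ˢ (univ : Finset (κ i)))
      ↑(univ.sigma A) := by
    rintro ⟨x, a⟩ hx
    simpa [swap, hA] using hx
  have hinj : Function.Injective swap :=
    Function.LeftInverse.injective (g := fun y ↦ (Function.update y.1 i y.2, y.1 i)) fun q ↦ by
      simp [swap]
  calc #{x | x i ∈ A x} * Fintype.card (κ i)
      = #(({x | x i ∈ A x} : Finset _) ×ˢ (univ : Finset (κ i))) := (card_product _ _).symm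
    _ ≤ #(univ.sigma A) := card_le_card_of_injOn swap hmaps hinj.injOn
    _ = ∑ x, #(A x) := card_sigma _ _
    _ ≤ Fintype.card (∀ j, κ j) * m := sum_le_card_nsmul _ _ _ fun x _ ↦ hcard x

theorem exists_forall_apply_notMem [Finite ι] {P κ : Type*} [Fintype P] [Fintype κ]
    {m : ℕ} (i : P → ι) (A : P → (ι → κ) → Finset κ)
    (hA : ∀ p x a, A p (Function.update x (i p) a) = A p x) (hcard : ∀ p x, #(A p x) ≤ m)
    (hm : Fintype.card P * m < Fintype.card κ) : ∃ x, ∀ p, x (i p) ∉ A p x := by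
  classical
  have := Fintype.ofFinite ι
  by_contra! hcover
  have hpos : 0 < Fintype.card (ι → κ) := by
    rw [Fintype.card_fun]
    exact Nat.pow_pos (by omega)
  have hsum : Fintype.card (ι → κ) ≤ ∑ p, #{x | x (i p) ∈ A p x} := by
    refine (card_le_card fun x _ ↦ ?_).trans card_biUnion_le
    simpa using hcover x
  have hcount :
      Fintype.card (ι → κ) * Fintype.card κ ≤ Fintype.card (ι → κ) * (Fintype.card P * m) :=
    calc Fintype.card (ι → κ) * Fintype.card κ
        ≤ ∑ p, #{x | x (i p) ∈ A p x} * Fintype.card κ := by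
          rw [← sum_mul]
          gcongr
      _ ≤ ∑ _p : P, Fintype.card (ι → κ) * m :=
          sum_le_sum fun p _ ↦ card_filter_apply_mem_mul_card_le (A p) (hA p) (hcard p)
      _ = Fintype.card (ι → κ) * (Fintype.card P * m) := by
          rw [sum_const, card_univ, smul_eq_mul, mul_left_comm]
  exact hm.not_ge (Nat.le_of_mul_le_mul_left hcount hpos)

end Avoidance

section Exclusive

variable {V W κ : Type*} {G : SimpleGraph W} {H : SimpleGraph V}

theorem IsDisjointing.apply_notMem_of_mem {f : H.edgeSet → H.edgeSet} (hf : IsDisjointing f)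
    (c : Copy G H) {e : G.edgeSet} {w : W} (hw : w ∈ (e : Sym2 W)) :
    c w ∉ (f (c.mapEdgeSet e) : Sym2 V) :=
  hf _ _ (Sym2.mem_map.2 ⟨w, hw, rfl⟩)

theorem mapEdgeSet_comp_transversal_update [DecidableEq W] (k : Copy (blowup G κ) H) (x : W → κ)
    {e : G.edgeSet} {w : W} (hw : w ∉ (e : Sym2 W)) (a : κ) :
    (k.comp (transversal G (Function.update x w a))).mapEdgeSet e =
      (k.comp (transversal G x)).mapEdgeSet e := by
  refine Subtype.ext (Sym2.map_congr fun v hv ↦ ?_)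
  have hvw : v ≠ w := fun h ↦ hw (h ▸ hv)
  exact congrArg (fun b ↦ k (v, b)) (Function.update_of_ne hvw a x)

theorem card_filter_apply_mem_sym2_le_two [Fintype κ] [DecidableEq V] {g : κ → V}
    (hg : Function.Injective g) (z : Sym2 V) : #{a | g a ∈ z} ≤ 2 := by
  have hmaps : Set.MapsTo g ({a | g a ∈ z} : Finset κ) z.toFinset := fun a ha ↦ by
    simpa using ha
  refine (card_le_card_of_injOn g hmaps hg.injOn).trans ?_
  rw [Sym2.card_toFinset]
  split_ifs <;> omega

theorem exists_isExclusive_transversal [Finite W] {f : H.edgeSet → H.edgeSet}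
    (hf : IsDisjointing f) (hκ : Nat.card G.edgeSet * Nat.card W * 2 < Nat.card κ)
    (k : Copy (blowup G κ) H) : ∃ x, IsExclusive f (k.comp (transversal G x)) := by
  classical
  have := Fintype.ofFinite W
  have := Nat.finite_of_card_ne_zero hκ.ne_bot
  have := Fintype.ofFinite κ
  let P := {p : G.edgeSet × W // p.2 ∉ (p.1 : Sym2 W)}
  have hP : Fintype.card P * 2 < Fintype.card κ := by
    rw [← Nat.card_prod, Nat.card_eq_fintype_card, Nat.card_eq_fintype_card] at hκ
    exact (Nat.mul_le_mul_right 2 (Fintype.card_subtype_le _)).trans_lt hκ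
  let A : P → (W → κ) → Finset κ := fun p x ↦
    {a | k (p.1.2, a) ∈ (f ((k.comp (transversal G x)).mapEdgeSet p.1.1) : Sym2 V)}
  obtain ⟨x, hx⟩ := exists_forall_apply_notMem (m := 2) (fun p : P ↦ p.1.2) A
    (fun p x a ↦ by simp only [A, mapEdgeSet_comp_transversal_update k x p.2 a])
    (fun p x ↦ card_filter_apply_mem_sym2_le_two
      (k.injective.comp (Prod.mk_right_injective p.1.2)) _) hP
  refine ⟨x, fun e w ↦ ?_⟩
  by_cases hw : w ∈ (e : Sym2 W)
  · exact hf.apply_notMem_of_mem _ hw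
  · simpa [A] using! hx ⟨(e, w), hw⟩

theorem HasAvoidingMap.blowup_free [Finite W] (h : HasAvoidingMap G H)
    (hκ : Nat.card G.edgeSet * Nat.card W * 2 < Nat.card κ) : (blowup G κ).Free H := by
  rintro ⟨k⟩
  obtain ⟨f, hf, havoid⟩ := h
  obtain ⟨x, hx⟩ := exists_isExclusive_transversal hf hκ k
  exact havoid _ hx

theorem exists_disjoint_edge [Fintype V] [DecidableRel H.Adj]
    (h : 2 * Fintype.card V ≤ #H.edgeFinset) (e : H.edgeSet) :
    ∃ e' : H.edgeSet, ∀ v ∈ (e : Sym2 V), v ∉ (e' : Sym2 V) := by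
  classical
  obtain ⟨⟨a, b⟩, he⟩ := e
  by_contra! hmeet
  have hsub : H.edgeFinset ⊆ H.incidenceFinset a ∪ H.incidenceFinset b := by
    intro e' he'
    rw [mem_edgeFinset] at he'
    obtain ⟨v, hv, hv'⟩ := hmeet ⟨e', he'⟩
    rw [mem_union, mem_incidenceFinset, mem_incidenceFinset]
    rcases Sym2.mem_iff.mp hv with rfl | rfl
    · exact Or.inl ⟨he', hv'⟩
    · exact Or.inr ⟨he', hv'⟩
  have hdegree : #H.edgeFinset ≤ H.degree a + H.degree b := by
    simpa only [card_incidenceFinset_eq_degree] using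
      (card_le_card hsub).trans (card_union_le _ _)
  have ha := H.degree_lt_card_verts a
  have hb := H.degree_lt_card_verts b
  omega

theorem hasAvoidingMap_of_free [Fintype V] [DecidableRel H.Adj] (hfree : G.Free H)
    (h : 2 * Fintype.card V ≤ #H.edgeFinset) : HasAvoidingMap G H := by
  choose f hf using exists_disjoint_edge h
  exact ⟨f, hf, fun c ↦ absurd ⟨c⟩ hfree⟩

end Exclusive

section Extremal

variable {W : Type*} {G : SimpleGraph W} {n : ℕ}

theorem HasAvoidingMap.card_edgeFinset_le_s {H : SimpleGraph (Fin n)} [DecidableRel H.Adj]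
    (h : HasAvoidingMap G H) : #H.edgeFinset ≤ s n G := by
  classical
  rw [s]
  convert! le_sup (f := fun H : SimpleGraph (Fin n) ↦ #H.edgeFinset) (mem_filter_univ H |>.2 h)

theorem extremalNumber_le_s (h : 2 * n ≤ extremalNumber n G) : extremalNumber n G ≤ s n G := by
  by_contra! hlt
  have hmax : max (s n G) (2 * n - 1) < extremalNumber (Fintype.card (Fin n)) G := by
    rw [Fintype.card_fin]
    omega
  obtain ⟨H, _, hfree, hcard⟩ := (lt_extremalNumber_iff G _).1 hmax
  have havoid : HasAvoidingMap G H := hasAvoidingMap_of_free hfree (by rw [Fintype.card_fin]; omega)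
  have := havoid.card_edgeFinset_le_s
  omega

theorem s_le_extremalNumber_blowup [Finite W] {κ : Type*}
    (hκ : Nat.card G.edgeSet * Nat.card W * 2 < Nat.card κ) :
    s n G ≤ extremalNumber n (blowup G κ) := by
  classical
  refine Finset.sup_le fun H hH ↦ ?_
  have := card_edgeFinset_le_extremalNumber (((mem_filter_univ H).1 hH).blowup_free hκ)
  rw [Fintype.card_fin] at this
  convert this

theorem exists_s_le_extremalNumber_blowup [Finite W] (G : SimpleGraph W) :
    ∃ t : ℕ, 0 < t ∧ ∀ n, s n G ≤ extremalNumber n (blowup G (Fin t)) :=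
  ⟨Nat.card G.edgeSet * Nat.card W * 2 + 1, Nat.succ_pos _, fun _ ↦
    s_le_extremalNumber_blowup (by simp)⟩

theorem isEquivalent_s_of_turanDensity_eq {W' : Type*} {K : SimpleGraph W'}
    (hpos : 0 < turanDensity G) (hK : turanDensity K = turanDensity G)
    (hle : ∀ n, s n G ≤ extremalNumber n K) :
    (fun n : ℕ ↦ (s n G : ℝ)) ~[atTop] (fun n : ℕ ↦ (extremalNumber n G : ℝ)) := by
  have hequiv : (fun n : ℕ ↦ (extremalNumber n K : ℝ)) ~[atTop]
      (fun n : ℕ ↦ (extremalNumber n G : ℝ)) := by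
    have hKG := isEquivalent_extremalNumber (H := K) (hK ▸ hpos.ne')
    rw [hK] at hKG
    exact hKG.trans (isEquivalent_extremalNumber hpos.ne').symm
  refine (IsBigO.of_norm_eventuallyLE ?_).trans_isLittleO hequiv.isLittleO
  filter_upwards [eventually_two_mul_le_extremalNumber hpos] with n hn
  have hlower : (extremalNumber n G : ℝ) ≤ s n G := by exact_mod_cast extremalNumber_le_s hn
  have hupper : (s n G : ℝ) ≤ extremalNumber n K := by exact_mod_cast hle n
  simp only [Pi.sub_apply, Real.norm_of_nonneg (sub_nonneg.2 hlower)]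
  linarith

theorem isEquivalent_s_extremalNumber [Finite W] {r : ℕ} (hr : 2 ≤ r)
    (h : G.chromaticNumber = r + 1) :
    (fun n : ℕ ↦ (s n G : ℝ)) ~[atTop] (fun n : ℕ ↦ (extremalNumber n G : ℝ)) := by
  obtain ⟨t, ht, hle⟩ := exists_s_le_extremalNumber_blowup G
  have : NeZero t := ⟨ht.ne'⟩
  have hr0 : 0 < r := by omega
  have hdensity : turanDensity G = 1 - 1 / r := turanDensity_eq_of_chromaticNumber_eq hr0 h
  have hblowup : turanDensity (blowup G (Fin t)) = 1 - 1 / r :=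
    turanDensity_eq_of_chromaticNumber_eq hr0 ((chromaticNumber_blowup G).trans h)
  have hinv : 1 / (r : ℝ) < 1 := by
    rw [div_lt_one (by positivity)]
    exact_mod_cast hr
  exact isEquivalent_s_of_turanDensity_eq (by linarith) (hblowup.trans hdensity.symm) hle

theorem isLittleO_s_of_isBipartite [Finite W] (h : G.IsBipartite) :
    (fun n : ℕ ↦ (s n G : ℝ)) =o[atTop] (fun n : ℕ ↦ (n : ℝ) ^ 2) := by
  obtain ⟨t, -, hle⟩ := exists_s_le_extremalNumber_blowup G
  have hbipartite : (blowup G (Fin t)).IsBipartite := h.of_hom ⟨Prod.fst, id⟩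
  refine IsBigO.trans_isLittleO (.of_norm_le fun n ↦ ?_)
    (isLittleO_extremalNumber_of_turanDensity_eq_zero
      (turanDensity_eq_zero_of_isBipartite hbipartite))
  rw [Real.norm_natCast]
  exact_mod_cast hle n

end Extremal

end EdgeMapping

theorem mainTheorem10 {W : Type*} [Finite W] (G : SimpleGraph W) :
    (3 ≤ G.chromaticNumber →
      (fun n : ℕ => (EdgeMapping.s n G : ℝ)) ~[atTop]
        (fun n : ℕ => (SimpleGraph.extremalNumber n G : ℝ))) ∧
    (G.IsBipartite →
      (fun n : ℕ => (EdgeMapping.s n G : ℝ)) =o[atTop] (fun n : ℕ => (n : ℝ) ^ 2)) := by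
  refine ⟨fun hthree ↦ ?_, EdgeMapping.isLittleO_s_of_isBipartite⟩
  have := Fintype.ofFinite W
  obtain ⟨χ, hχ⟩ := ENat.ne_top_iff_exists.1
    (SimpleGraph.chromaticNumber_ne_top_iff_exists.2 ⟨_, G.colorable_of_fintype⟩)
  have hthree' : 3 ≤ χ := by rwa [← hχ, Nat.ofNat_le_cast] at hthree
  obtain ⟨r, rfl⟩ := Nat.exists_eq_add_of_le' (by omega : 1 ≤ χ)
  exact EdgeMapping.isEquivalent_s_extremalNumber (r := r) (by omega) (by simpa using hχ.symm)
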